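/- For integers $r\ge 1$, $s\ge r$ and $n\ge 0$, let a Turán $(n,s,r)$-system be a family $\mathcal H$ of $r$-element subsets (edges) of an $n$-element set $V$ such that every $s$-element subset of $V$ contains at least one edge of $\mathcal H$, and let $T(n,s,r)$ be the smallest possible number of edges of such a system. Let $$t(s,r)=\lim_{n\to\infty}\frac{T(n,s,r)}{\binom nr}$$ (the limit exists) and $\mu(s,r)=t(s,r)\binom sr$. **Theorem.** For every real $\varepsilon>0$ there exists $r_0$ such that the following statements hold for all integers $r\ge 1$ and $R\ge r_0$. (i) $\displaystyle \mu(r+R,r)\le (1+\varepsilon)\,R\,\ln\binom{r+R}{R}$. (ii) If in addition $R\le\sqrt{18\,r\ln r}$, then $\displaystyle \mu(r+R,r)\le e^{18R^2/r}\cdot(1+\varepsilon)\,R\ln R$. -/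

import Mathlib

open Filter Topology

/-- `IsTuranSystem s r H`: the family `H` of finite subsets of `V` is an `r`-graph on the vertex
set `V` (all its edges have exactly `r` elements), and every `s`-subset of `V` contains at least
one edge of `H`. For `V` with `n` elements this is a Turán `(n,s,r)`-system. -/
def IsTuranSystem {V : Type*} (s r : ℕ) (H : Finset (Finset V)) : Prop :=
  (∀ e ∈ H, e.card = r) ∧ ∀ S : Finset V, S.card = s → ∃ e ∈ H, e ⊆ S

/-- `T(n,s,r)`: the smallest number of edges of a Turán `(n,s,r)`-system. -/
noncomputable def turanNumber (n s r : ℕ) : ℕ :=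
  sInf {m : ℕ | ∃ H : Finset (Finset (Fin n)), IsTuranSystem s r H ∧ H.card = m}

/-- `t(s,r) = lim_{n → ∞} T(n,s,r) / C(n,r)`. The limit exists whenever `r ≤ s`, see
`tendsto_turanDensity` below. -/
noncomputable def turanDensity (s r : ℕ) : ℝ :=
  limUnder atTop fun n : ℕ => (turanNumber n s r : ℝ) / (n.choose r : ℝ)

/-- `μ(s,r) = t(s,r) · C(s,r)`. -/
noncomputable def turanMu (s r : ℕ) : ℝ :=
  turanDensity s r * (s.choose r : ℝ)

/-- The complete `r`-graph on `n` vertices is a Turán `(n,s,r)`-system. -/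
theorem isTuranSystem_complete (n : ℕ) {s r : ℕ} (h : r ≤ s) :
    IsTuranSystem s r (Finset.powersetCard r (Finset.univ : Finset (Fin n))) := by
  refine ⟨fun e he => (Finset.mem_powersetCard.1 he).2, fun S hS => ?_⟩
  obtain ⟨e, heS, hec⟩ := Finset.exists_subset_card_eq (hS ▸ h : r ≤ S.card)
  exact ⟨e, Finset.mem_powersetCard.2 ⟨Finset.subset_univ _, hec⟩, heS⟩

/-- The minimum in the definition of `T(n,s,r)` is attained when `r ≤ s`. -/
theorem exists_turanNumber (n : ℕ) {s r : ℕ} (h : r ≤ s) :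
    ∃ H : Finset (Finset (Fin n)), IsTuranSystem s r H ∧ H.card = turanNumber n s r :=
  Nat.sInf_mem (s := {m : ℕ | ∃ H : Finset (Finset (Fin n)), IsTuranSystem s r H ∧ H.card = m})
    ⟨_, _, isTuranSystem_complete n h, rfl⟩

theorem turanNumber_le_card {n s r : ℕ} {H : Finset (Finset (Fin n))}
    (hH : IsTuranSystem s r H) : turanNumber n s r ≤ H.card :=
  Nat.sInf_le ⟨H, hH, rfl⟩

theorem turanNumber_le_choose (n : ℕ) {s r : ℕ} (h : r ≤ s) :
    turanNumber n s r ≤ n.choose r := by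
  simpa using turanNumber_le_card (isTuranSystem_complete n h)

/-- Averaging over the vertex deletions of a minimum system. -/
theorem turanNumber_averaging (n : ℕ) {s r : ℕ} (h : r ≤ s) :
    (n + 1) * turanNumber n s r ≤ (n + 1 - r) * turanNumber (n + 1) s r := by
  classical
  obtain ⟨H, hH, hcard⟩ := exists_turanNumber (n + 1) h
  have key : ∀ v : Fin (n + 1), turanNumber n s r ≤ (H.filter fun e => v ∉ e).card := by
    intro v
    let G : Finset (Finset (Fin n)) :=
      Finset.univ.filter fun e => e.map v.succAboveEmb ∈ H
    have hG : IsTuranSystem s r G := by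
      refine ⟨fun e he => ?_, fun S hS => ?_⟩
      · have := hH.1 _ (Finset.mem_filter.1 he).2
        simpa using this
      · obtain ⟨e, heH, heS⟩ := hH.2 (S.map v.succAboveEmb) (by simpa using hS)
        obtain ⟨u, huS, rfl⟩ := Finset.subset_map_iff.1 heS
        exact ⟨u, Finset.mem_filter.2 ⟨Finset.mem_univ _, heH⟩, huS⟩
    refine (turanNumber_le_card hG).trans ?_
    refine Finset.card_le_card_of_injOn (fun e => e.map v.succAboveEmb) ?_ ?_
    · intro e he
      have he' := (Finset.mem_filter.1 (Finset.mem_coe.1 he)).2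
      refine Finset.mem_coe.2 (Finset.mem_filter.2 ⟨he', ?_⟩)
      simp [Fin.succAbove_ne]
    · exact fun a _ b _ hab => Finset.map_injective _ hab
  have hsum : ∑ v : Fin (n + 1), (H.filter fun e => v ∉ e).card = (n + 1 - r) * H.card := by
    simp_rw [Finset.card_filter]
    rw [Finset.sum_comm]
    have : ∀ e ∈ H, (∑ v : Fin (n + 1), if v ∉ e then 1 else 0) = n + 1 - r := by
      intro e he
      rw [← Finset.card_filter, ← hH.1 e he]
      have : (Finset.univ.filter fun v => v ∉ e) = eᶜ := by ext; simp
      rw [this, Finset.card_compl, Fintype.card_fin]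
    rw [Finset.sum_congr rfl this, Finset.sum_const, smul_eq_mul, mul_comm]
  calc (n + 1) * turanNumber n s r = ∑ _v : Fin (n + 1), turanNumber n s r := by simp
    _ ≤ ∑ v : Fin (n + 1), (H.filter fun e => v ∉ e).card := Finset.sum_le_sum fun v _ => key v
    _ = (n + 1 - r) * turanNumber (n + 1) s r := by rw [hsum, hcard]

theorem turanRatio_monotone {s r : ℕ} (h : r ≤ s) :
    Monotone fun n : ℕ => (turanNumber n s r : ℝ) / (n.choose r : ℝ) := by
  refine monotone_nat_of_le_succ fun n => ?_
  rcases lt_or_ge n r with hn | hn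
  · rw [Nat.choose_eq_zero_of_lt hn]
    simp only [Nat.cast_zero, div_zero]
    positivity
  · have h1 : (0 : ℝ) < (n.choose r : ℝ) := by exact_mod_cast Nat.choose_pos hn
    have h2 : (0 : ℝ) < ((n + 1).choose r : ℝ) := by
      exact_mod_cast Nat.choose_pos (hn.trans n.le_succ)
    have h3 : (0 : ℝ) < ((n + 1 - r : ℕ) : ℝ) := by
      exact_mod_cast (by omega : 0 < n + 1 - r)
    have ha : ((n : ℝ) + 1) * turanNumber n s r
        ≤ ((n + 1 - r : ℕ) : ℝ) * turanNumber (n + 1) s r := by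
      exact_mod_cast turanNumber_averaging n h
    have hc : (n.choose r : ℝ) * ((n : ℝ) + 1)
        = ((n + 1).choose r : ℝ) * ((n + 1 - r : ℕ) : ℝ) := by
      exact_mod_cast Nat.choose_mul_succ_eq n r
    rw [div_le_div_iff₀ h1 h2]
    refine le_of_mul_le_mul_right ?_ h3
    calc (turanNumber n s r : ℝ) * ((n + 1).choose r) * ((n + 1 - r : ℕ) : ℝ)
        = (n.choose r : ℝ) * (((n : ℝ) + 1) * turanNumber n s r) := by
          rw [mul_assoc, ← hc]; ring
      _ ≤ (n.choose r : ℝ) * (((n + 1 - r : ℕ) : ℝ) * turanNumber (n + 1) s r) :=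
          mul_le_mul_of_nonneg_left ha h1.le
      _ = turanNumber (n + 1) s r * (n.choose r : ℝ) * ((n + 1 - r : ℕ) : ℝ) := by ring

/-- The limit defining `t(s,r)` exists. -/
theorem tendsto_turanDensity {s r : ℕ} (h : r ≤ s) :
    Tendsto (fun n : ℕ => (turanNumber n s r : ℝ) / (n.choose r : ℝ)) atTop
      (𝓝 (turanDensity s r)) := by
  refine tendsto_nhds_limUnder ⟨_, tendsto_atTop_ciSup (turanRatio_monotone h) ⟨1, ?_⟩⟩
  rintro _ ⟨n, rfl⟩
  exact div_le_one_of_le₀ (by exact_mod_cast turanNumber_le_choose n h) (by positivity)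

/-! Write `C` for the binomial coefficient `C(r+R,R)`.

For (i), take each `r`-subset of a `q`-set with probability `p` and add one edge inside every
`(r+R)`-set that is missed. Blowing this system up to any number of vertices forces in the `r`-sets
that meet a part twice. With `q = r²C` these cost only `1` in `μ`, and `μ ≤ 2 + R log (r²C)` follows
(`turanMu_random_le`). Since `C` outgrows every fixed power of `r` uniformly as `R → ∞`, the surplus
is absorbed by `ε`.

For (ii), order the vertices, write `r = a + d + R`, and cut each `(r+R)`-set after its first `a +
R` elements (`turanNumber_prefix_le`). If this prefix contains an `a`-set from a sparse random
family, that `a`-set together with the whole suffix is an edge. Otherwise the suffix, of size `d +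
R`, contains an edge of a `(d+R,d)`-system, which is joined to the whole prefix. Edges of the second
kind are rare because a prefix seldom misses all its `a`-subsets. The smaller system therefore
affects the required density only through the logarithm of its size.

Three ranges of `r` are combined. If `r ≥ 2mR²`, the choice `d + R ≈ r/(mR)` keeps `C / C(a+R,R) ≤
e^(3/m)` and `C / C(d+R,R) ≤ (4mR)^R`, so the cost is about `R log R`. The smaller system only needs
the crude bound `μ ≤ R³`, which propagates by strong induction, with (i) covering small `r`
(`turanMu_recursive_le`). If `18R²/log R < r < 2mR²`, taking `d = 0` costs `e^(18R²/r) log C`, and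
`log C` is close to `R log R`. If `r log R ≤ 18R²`, the factor `e^(18R²/r)` is at least `R` and (i)
is enough. -/

/-! ### Averaging over random subsets and random permutations -/

/-- Derandomized selection: if each element of `A` is kept with probability `p`, some outcome is
at most as costly as the expectation. -/
theorem exists_subset_cost_le {α ι : Type*} [DecidableEq α] {p : ℝ} (hp₀ : 0 ≤ p) (hp₁ : p ≤ 1)
    (w : α → ℝ) (F : ι → Finset α) (A : Finset α) (J : Finset ι) :
    ∃ C ⊆ A, ∑ x ∈ C, w x + ((J.filter fun j => Disjoint (F j) C).card : ℝ) ≤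
      p * ∑ x ∈ A, w x + ∑ j ∈ J, (1 - p) ^ (F j ∩ A).card := by
  induction A using Finset.induction_on generalizing J with
  | empty => exact ⟨∅, subset_rfl, by simp⟩
  | insert x A hx ih =>
    obtain ⟨C₀, hC₀, h₀⟩ := ih J
    obtain ⟨C₁, hC₁, h₁⟩ := ih (J.filter fun j => x ∉ F j)
    have hxC : x ∉ C₁ := fun h => hx (hC₁ h)
    set a := ∑ j ∈ J.filter (fun j => x ∉ F j), (1 - p) ^ (F j ∩ A).card
    set b := ∑ j ∈ J.filter (fun j => ¬ x ∉ F j), (1 - p) ^ (F j ∩ A).card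
    have hab : ∑ j ∈ J, (1 - p) ^ (F j ∩ A).card = a + b :=
      (Finset.sum_filter_add_sum_filter_not J _ _).symm
    have hins : ∑ j ∈ J, (1 - p) ^ (F j ∩ insert x A).card = a + (1 - p) * b := by
      rw [← Finset.sum_filter_add_sum_filter_not J (fun j => x ∉ F j), Finset.mul_sum]
      congr 1
      · refine Finset.sum_congr rfl fun j hj => ?_
        rw [Finset.inter_insert_of_notMem (Finset.mem_filter.1 hj).2]
      · refine Finset.sum_congr rfl fun j hj => ?_
        rw [Finset.inter_insert_of_mem (not_not.1 (Finset.mem_filter.1 hj).2),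
          Finset.card_insert_of_notMem (fun h => hx (Finset.mem_inter.1 h).2), pow_succ']
    rw [hab] at h₀
    rw [hins, Finset.sum_insert hx]
    -- The target is the convex combination, with weights `1 - p` and `p`, of the bounds for
    -- omitting and for keeping `x`. These bounds differ by `b` against `w x`, and the cheaper
    -- option is taken.
    by_cases hle : b ≤ w x
    · refine ⟨C₀, hC₀.trans (Finset.subset_insert _ _), h₀.trans ?_⟩
      nlinarith
    · refine ⟨insert x C₁, Finset.insert_subset_insert _ hC₁, ?_⟩
      have hfil : (J.filter fun j => Disjoint (F j) (insert x C₁)) =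
          (J.filter fun j => x ∉ F j).filter fun j => Disjoint (F j) C₁ := by
        ext j
        simp [Finset.disjoint_insert_right, and_assoc]
      rw [hfil, Finset.sum_insert hxC]
      nlinarith

theorem exists_perm_map_eq {α : Type*} [Fintype α] [DecidableEq α] {X Y : Finset α}
    (h : X.card = Y.card) : ∃ σ : Equiv.Perm α, X.map σ.toEmbedding = Y := by
  let e : {x // x ∈ X} ≃ {x // x ∈ Y} := Finset.equivOfCardEq h
  refine ⟨e.extendSubtype, Finset.eq_of_subset_of_card_le ?_ (by simp [h])⟩
  intro y hy
  obtain ⟨x, hx, rfl⟩ := Finset.mem_map.1 hy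
  exact e.extendSubtype_mem x hx

/-- A fixed `k`-set is moved into a family `D` of `k`-sets by a random permutation with probability
`|D| / C(n,k)`. -/
theorem card_perm_map_mem_mul {n k : ℕ} {D : Finset (Finset (Fin n))} (hD : ∀ e ∈ D, e.card = k)
    {X : Finset (Fin n)} (hX : X.card = k) :
    (Finset.univ.filter fun σ : Equiv.Perm (Fin n) => X.map σ.toEmbedding ∈ D).card * n.choose k =
      n.factorial * D.card := by
  classical
  -- The count is the same for every `k`-set, because composing with a permutation that carries `X`
  -- to `Y` matches the two. Double counting pairs `(σ, Y)` then determines it.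
  have hinv : ∀ Y ∈ Finset.powersetCard k (Finset.univ : Finset (Fin n)),
      (Finset.univ.filter fun σ : Equiv.Perm (Fin n) => Y.map σ.toEmbedding ∈ D).card =
      (Finset.univ.filter fun σ : Equiv.Perm (Fin n) => X.map σ.toEmbedding ∈ D).card := by
    intro Y hY
    obtain ⟨τ, hτ⟩ := exists_perm_map_eq (hX.trans (Finset.mem_powersetCard.1 hY).2.symm)
    refine Finset.card_bij (fun σ _ => σ * τ) ?_ ?_ ?_
    · intro σ hσ
      simp only [Finset.mem_filter, Finset.mem_univ, true_and] at hσ ⊢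
      rw [← hτ, Finset.map_map] at hσ
      exact hσ
    · intro σ _ σ' _ h
      exact mul_right_cancel h
    · intro σ hσ
      refine ⟨σ * τ⁻¹, ?_, by simp⟩
      simp only [Finset.mem_filter, Finset.mem_univ, true_and] at hσ ⊢
      rw [← hτ, Finset.map_map]
      convert hσ using 2
      ext x
      simp
  have hcol : ∀ σ : Equiv.Perm (Fin n),
      ((Finset.powersetCard k (Finset.univ : Finset (Fin n))).filter
        fun Y => Y.map σ.toEmbedding ∈ D).card = D.card := by
    intro σ
    refine Finset.card_bij (fun Y _ => Y.map σ.toEmbedding) ?_ ?_ ?_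
    · intro Y hY
      exact (Finset.mem_filter.1 hY).2
    · intro Y _ Y' _ h
      exact Finset.map_injective _ h
    · intro e he
      have hm : (e.map σ.symm.toEmbedding).map σ.toEmbedding = e := by
        rw [Finset.map_map]
        ext x
        simp
      refine ⟨e.map σ.symm.toEmbedding, ?_, hm⟩
      simp only [Finset.mem_filter, Finset.mem_powersetCard, Finset.subset_univ, true_and,
        Finset.card_map, hm]
      exact ⟨hD e he, he⟩
  have h := Finset.sum_card_bipartiteAbove_eq_sum_card_bipartiteBelow
    (s := (Finset.univ : Finset (Equiv.Perm (Fin n))))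
    (t := Finset.powersetCard k (Finset.univ : Finset (Fin n)))
    (fun σ Y => Y.map σ.toEmbedding ∈ D)
  simp only [Finset.bipartiteAbove, Finset.bipartiteBelow] at h
  rw [Finset.sum_congr rfl (fun σ _ => hcol σ), Finset.sum_congr rfl hinv] at h
  simp only [Finset.sum_const, smul_eq_mul, Finset.card_univ, Fintype.card_perm, Fintype.card_fin,
    Finset.card_powersetCard] at h
  rw [h, mul_comm]

/-- Some permutation moves at most the average number of given `k`-sets into `D`. -/
theorem exists_perm_card_filter_mul_le {ι : Type*} {n k : ℕ} {D : Finset (Finset (Fin n))}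
    (hD : ∀ e ∈ D, e.card = k) (P : Finset ι) (g : ι → Finset (Fin n))
    (hg : ∀ i ∈ P, (g i).card = k) :
    ∃ σ : Equiv.Perm (Fin n),
      (P.filter fun i => (g i).map σ.toEmbedding ∈ D).card * n.choose k ≤ P.card * D.card := by
  classical
  by_contra! hcon
  have h := Finset.sum_card_bipartiteAbove_eq_sum_card_bipartiteBelow
    (s := (Finset.univ : Finset (Equiv.Perm (Fin n)))) (t := P)
    (fun σ i => (g i).map σ.toEmbedding ∈ D)
  simp only [Finset.bipartiteAbove, Finset.bipartiteBelow] at h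
  have h1 : ∑ _σ : Equiv.Perm (Fin n), P.card * D.card <
      (∑ σ : Equiv.Perm (Fin n),
        (P.filter fun i => (g i).map σ.toEmbedding ∈ D).card) * n.choose k := by
    rw [Finset.sum_mul]
    exact Finset.sum_lt_sum_of_nonempty Finset.univ_nonempty fun σ _ => hcon σ
  rw [h, Finset.sum_mul,
    Finset.sum_congr rfl fun i hi => card_perm_map_mem_mul hD (hg i hi)] at h1
  simp only [Finset.sum_const, smul_eq_mul, Finset.card_univ, Fintype.card_perm,
    Fintype.card_fin] at h1
  exact absurd h1 (by rw [mul_left_comm]; exact lt_irrefl _)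

theorem IsTuranSystem.image_perm {n s r : ℕ} {H : Finset (Finset (Fin n))}
    (hH : IsTuranSystem s r H) (σ : Equiv.Perm (Fin n)) {S : Finset (Fin n)} (hS : S.card = s) :
    ∃ e ⊆ S, e.card = r ∧ e.map σ.toEmbedding ∈ H := by
  obtain ⟨e, he, heS⟩ := hH.2 (S.map σ.toEmbedding) (by simpa using hS)
  obtain ⟨u, hu, rfl⟩ := Finset.subset_map_iff.1 heS
  exact ⟨u, hu, by simpa using hH.1 _ he, he⟩

/-! ### Ordered splittings and the prefix construction -/

/-- `u` precedes `v` if all elements of `u` are smaller than all elements of `v`. -/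
def Precedes {n : ℕ} (u v : Finset (Fin n)) : Prop := ∀ x ∈ u, ∀ y ∈ v, x < y

theorem Precedes.mono {n : ℕ} {u v u' v' : Finset (Fin n)} (h : Precedes u v) (hu : u' ⊆ u)
    (hv : v' ⊆ v) : Precedes u' v' := fun x hx y hy => h x (hu hx) y (hv hy)

theorem Precedes.disjoint {n : ℕ} {u v : Finset (Fin n)} (h : Precedes u v) : Disjoint u v :=
  Finset.disjoint_left.2 fun x hx hy => lt_irrefl _ (h x hx x hy)

/-- If `u ≠ u'`, equal size gives `x ∈ u \ u'` and `y ∈ u' \ u`. Then `x ∈ v'` and `y ∈ v`, so both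
`x < y` and `y < x`. This uniqueness bounds the number of split `r`-sets by the number of `r`-sets.
-/
theorem Precedes.eq_of_union_eq {n : ℕ} {u v u' v' : Finset (Fin n)} (h : Precedes u v)
    (h' : Precedes u' v') (hc : u.card = u'.card) (hu : u ∪ v = u' ∪ v') : u = u' ∧ v = v' := by
  have key : u = u' := by
    by_contra hne
    have h1 : ¬ u ⊆ u' := fun hs => hne (Finset.eq_of_subset_of_card_le hs hc.ge)
    have h2 : ¬ u' ⊆ u := fun hs => hne (Finset.eq_of_subset_of_card_le hs hc.le).symm
    obtain ⟨x, hx, hx'⟩ := Finset.not_subset.1 h1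
    obtain ⟨y, hy, hy'⟩ := Finset.not_subset.1 h2
    have hxv : x ∈ v' := by
      have : x ∈ u' ∪ v' := hu ▸ Finset.mem_union_left _ hx
      exact (Finset.mem_union.1 this).resolve_left hx'
    have hyv : y ∈ v := by
      have : y ∈ u ∪ v := hu ▸ Finset.mem_union_left _ hy
      exact (Finset.mem_union.1 this).resolve_left hy'
    exact lt_asymm (h x hx y hyv) (h' y hy x hxv)
  refine ⟨key, ?_⟩
  rw [← Finset.union_sdiff_cancel_left h.disjoint, hu, key,
    Finset.union_sdiff_cancel_left h'.disjoint]

theorem exists_precedes_union_eq {n : ℕ} (S : Finset (Fin n)) {k : ℕ} (hk : k ≤ S.card) :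
    ∃ u v, Precedes u v ∧ u ∪ v = S ∧ u.card = k := by
  induction k with
  | zero => exact ⟨∅, S, by simp [Precedes], by simp, rfl⟩
  | succ k ih =>
    obtain ⟨u, v, huv, rfl, hu⟩ := ih (by omega)
    have hv : v.Nonempty := by
      rw [← Finset.card_pos]
      rw [Finset.card_union_of_disjoint huv.disjoint] at hk
      omega
    have hm := v.min'_mem hv
    refine ⟨insert (v.min' hv) u, v.erase (v.min' hv), ?_, ?_, ?_⟩
    · intro x hx y hy
      rcases Finset.mem_insert.1 hx with rfl | hx
      · exact Finset.min'_lt_of_mem_erase_min' _ _ hy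
      · exact huv x hx y (Finset.mem_of_mem_erase hy)
    · rw [Finset.insert_union, ← Finset.union_insert, Finset.insert_erase hm]
    · rw [Finset.card_insert_of_notMem (Finset.disjoint_right.1 huv.disjoint hm), hu]

/-- The prefix construction. The edges are the sets whose first `a` elements form a member of a
sparse family, or whose first `a + R` elements contain no such member while the remaining elements
form an edge of a `(d + R, d)`-system. -/
theorem turanNumber_prefix_le (n a d R : ℕ) {p : ℝ} (hp₀ : 0 ≤ p) (hp₁ : p ≤ 1) (hd : d ≤ n) :
    (turanNumber n (a + d + R + R) (a + d + R) : ℝ) ≤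
      p * (n.choose (a + d + R)) + (1 - p) ^ (a + R).choose a *
        ((n.choose (a + d + R)) * ((turanNumber n (d + R) d : ℝ) / (n.choose d))) := by
  classical
  set U : Finset (Finset (Fin n)) := Finset.powersetCard (a + d + R) Finset.univ with hU
  have hUc : U.card = n.choose (a + d + R) := by simp [hU]
  -- The `r`-sets, `r = a + d + R`, each cut after its `k` smallest elements.
  let Q : ℕ → Finset (Finset (Fin n) × Finset (Fin n)) := fun k =>
    Finset.univ.filter fun z => Precedes z.1 z.2 ∧ z.1.card = k ∧ z.1 ∪ z.2 ∈ U
  have hQ : ∀ k, (Q k).card ≤ n.choose (a + d + R) := by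
    intro k
    rw [← hUc]
    refine Finset.card_le_card_of_injOn (fun z => z.1 ∪ z.2) ?_ ?_
    · intro z hz
      exact (Finset.mem_filter.1 hz).2.2.2
    · intro z hz z' hz' h
      have hz := (Finset.mem_filter.1 (Finset.mem_coe.1 hz)).2
      have hz' := (Finset.mem_filter.1 (Finset.mem_coe.1 hz')).2
      have := hz.1.eq_of_union_eq hz'.1 (hz.2.1.trans hz'.2.1.symm) h
      exact Prod.ext this.1 this.2
  have hQd : ∀ z ∈ Q (a + R), z.2.card = d := by
    intro z hz
    obtain ⟨h1, h2, h3⟩ := (Finset.mem_filter.1 hz).2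
    have := (Finset.mem_powersetCard.1 h3).2
    rw [Finset.card_union_of_disjoint h1.disjoint] at this
    omega
  obtain ⟨D, hD, hDc⟩ := exists_turanNumber n (Nat.le_add_right d R)
  -- The suffixes of `r`-sets are not equidistributed among the `d`-sets, so `D` itself might
  -- contain too many of them. A suitable relabelling of `D` has at most the average number.
  obtain ⟨σ, hσ⟩ := exists_perm_card_filter_mul_le hD.1 (Q (a + R)) Prod.snd hQd
  set J := (Q (a + R)).filter fun z => z.2.map σ.toEmbedding ∈ D with hJ
  set A : Finset (Finset (Fin n)) := Finset.powersetCard a Finset.univ with hA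
  have hJc : (J.card : ℝ) ≤ n.choose (a + d + R) * ((turanNumber n (d + R) d : ℝ) / n.choose d) := by
    have hpos : (0 : ℝ) < n.choose d := by exact_mod_cast Nat.choose_pos hd
    rw [← mul_div_assoc, le_div_iff₀ hpos, ← hDc]
    exact_mod_cast hσ.trans (Nat.mul_le_mul_right _ (hQ _))
  -- Keeping an `a`-set costs the number of `r`-sets that begin with it. A candidate in `J` costs
  -- `1` if its prefix contains no chosen `a`-set.
  obtain ⟨C, hCA, hC⟩ := exists_subset_cost_le hp₀ hp₁
    (fun x : Finset (Fin n) => (((Q a).filter fun z => z.1 = x).card : ℝ))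
    (fun z : Finset (Fin n) × Finset (Fin n) => Finset.powersetCard a z.1) A J
  set H₁ := ((Q a).filter fun z => z.1 ∈ C).image fun z => z.1 ∪ z.2
  set H₂ := (J.filter fun z => Disjoint (Finset.powersetCard a z.1) C).image fun z => z.1 ∪ z.2
  have hH : IsTuranSystem (a + d + R + R) (a + d + R) (H₁ ∪ H₂) := by
    constructor
    · intro e he
      rcases Finset.mem_union.1 he with he | he
      · obtain ⟨z, hz, rfl⟩ := Finset.mem_image.1 he
        have hz := (Finset.mem_filter.1 (Finset.mem_filter.1 hz).1).2
        exact (Finset.mem_powersetCard.1 hz.2.2).2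
      · obtain ⟨z, hz, rfl⟩ := Finset.mem_image.1 he
        have hz := (Finset.mem_filter.1 (Finset.mem_filter.1 (Finset.mem_filter.1 hz).1).1).2
        exact (Finset.mem_powersetCard.1 hz.2.2).2
    · intro S hS
      obtain ⟨u, v, huv, rfl, hu⟩ := exists_precedes_union_eq S (k := a + R) (by omega)
      rw [Finset.card_union_of_disjoint huv.disjoint] at hS
      by_cases hdis : Disjoint (Finset.powersetCard a u) C
      · obtain ⟨e, hev, hec, heD⟩ := hD.image_perm σ (S := v) (by omega)
        have hue := huv.mono subset_rfl hev
        refine ⟨u ∪ e, Finset.mem_union_right _ (Finset.mem_image.2 ⟨(u, e), ?_, rfl⟩),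
          Finset.union_subset_union_right hev⟩
        refine Finset.mem_filter.2 ⟨Finset.mem_filter.2 ⟨Finset.mem_filter.2
          ⟨Finset.mem_univ _, hue, hu, Finset.mem_powersetCard.2 ⟨Finset.subset_univ _, ?_⟩⟩,
            heD⟩, hdis⟩
        rw [Finset.card_union_of_disjoint hue.disjoint]
        omega
      · obtain ⟨x, hxu, hxC⟩ := Finset.not_disjoint_iff.1 hdis
        obtain ⟨hxu, hxa⟩ := Finset.mem_powersetCard.1 hxu
        have hxv := huv.mono hxu subset_rfl
        refine ⟨x ∪ v, Finset.mem_union_left _ (Finset.mem_image.2 ⟨(x, v), ?_, rfl⟩),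
          Finset.union_subset_union_left hxu⟩
        refine Finset.mem_filter.2 ⟨Finset.mem_filter.2
          ⟨Finset.mem_univ _, hxv, hxa, Finset.mem_powersetCard.2 ⟨Finset.subset_univ _, ?_⟩⟩,
            hxC⟩
        rw [Finset.card_union_of_disjoint hxv.disjoint]
        omega
  have hfib : ∀ B : Finset (Finset (Fin n)),
      ∑ x ∈ B, (((Q a).filter fun z => z.1 = x).card : ℝ) =
        (((Q a).filter fun z => z.1 ∈ B).card : ℝ) := by
    intro B
    rw [Finset.card_eq_sum_card_fiberwise (s := (Q a).filter fun z => z.1 ∈ B)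
      (f := Prod.fst) (t := B) (fun z hz => (Finset.mem_filter.1 hz).2)]
    push_cast
    refine Finset.sum_congr rfl fun x hx => ?_
    congr 2
    ext z
    simp only [Finset.mem_filter]
    constructor
    · rintro ⟨h1, rfl⟩
      exact ⟨⟨h1, hx⟩, rfl⟩
    · rintro ⟨⟨h1, _⟩, h2⟩
      exact ⟨h1, h2⟩
  have hexp : ∑ z ∈ J, (1 - p) ^ (Finset.powersetCard a z.1 ∩ A).card =
      J.card * (1 - p) ^ (a + R).choose a := by
    rw [← nsmul_eq_mul, ← Finset.sum_const]
    refine Finset.sum_congr rfl fun z hz => ?_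
    have hz := (Finset.mem_filter.1 (Finset.mem_filter.1 hz).1).2
    rw [Finset.inter_eq_left.2 (Finset.powersetCard_mono (Finset.subset_univ _)),
      Finset.card_powersetCard, hz.2.1]
  rw [hfib, hfib, hexp] at hC
  have hAle : (((Q a).filter fun z => z.1 ∈ A).card : ℝ) ≤ n.choose (a + d + R) := by
    exact_mod_cast (Finset.card_filter_le _ _).trans (hQ a)
  calc (turanNumber n (a + d + R + R) (a + d + R) : ℝ) ≤ ((H₁ ∪ H₂).card : ℝ) := by
        exact_mod_cast turanNumber_le_card hH
    _ ≤ (((Q a).filter fun z => z.1 ∈ C).card : ℝ) +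
        ((J.filter fun z => Disjoint (Finset.powersetCard a z.1) C).card : ℝ) := by
        exact_mod_cast (Finset.card_union_le _ _).trans
          (Nat.add_le_add Finset.card_image_le Finset.card_image_le)
    _ ≤ _ := hC
    _ ≤ _ := by
        rw [mul_comm (J.card : ℝ)]
        exact add_le_add (mul_le_mul_of_nonneg_left hAle hp₀)
          (mul_le_mul_of_nonneg_left hJc (pow_nonneg (by linarith) _))

theorem turanDensity_prefix_le (a d R : ℕ) {p : ℝ} (hp₀ : 0 ≤ p) (hp₁ : p ≤ 1) :
    turanDensity (a + d + R + R) (a + d + R) ≤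
      p + (1 - p) ^ (a + R).choose a * turanDensity (d + R) d := by
  refine le_of_tendsto_of_tendsto (tendsto_turanDensity (Nat.le_add_right _ _))
    (((tendsto_turanDensity (Nat.le_add_right d R)).const_mul _).const_add _) ?_
  filter_upwards [eventually_ge_atTop (a + d + R)] with n hn
  have hpos : (0 : ℝ) < n.choose (a + d + R) := by exact_mod_cast Nat.choose_pos hn
  rw [div_le_iff₀ hpos]
  exact (turanNumber_prefix_le n a d R hp₀ hp₁ (by omega)).trans (le_of_eq (by ring))

/-! ### Random systems and blow-ups -/

/-- Sparse random family plus one edge for every set that it misses. -/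
theorem turanNumber_random_le (q : ℕ) {s r : ℕ} (h : r ≤ s) {p : ℝ} (hp₀ : 0 ≤ p) (hp₁ : p ≤ 1) :
    (turanNumber q s r : ℝ) ≤ p * q.choose r + (1 - p) ^ s.choose r * q.choose s := by
  classical
  obtain ⟨C, hCA, hC⟩ := exists_subset_cost_le hp₀ hp₁ (fun _ => (1 : ℝ))
    (fun S : Finset (Fin q) => Finset.powersetCard r S) (Finset.powersetCard r Finset.univ)
    (Finset.powersetCard s Finset.univ)
  set B := (Finset.powersetCard s (Finset.univ : Finset (Fin q))).filter
    fun S => Disjoint (Finset.powersetCard r S) C with hB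
  have hch : ∀ S : Finset (Fin q), ∃ e, S ∈ B → e ⊆ S ∧ e.card = r := by
    intro S
    by_cases hS : S ∈ B
    · have hc := (Finset.mem_powersetCard.1 (Finset.mem_filter.1 hS).1).2
      obtain ⟨e, he⟩ := Finset.exists_subset_card_eq (hc ▸ h : r ≤ S.card)
      exact ⟨e, fun _ => he⟩
    · exact ⟨∅, fun h => absurd h hS⟩
  choose f hf using hch
  have hH : IsTuranSystem s r (C ∪ B.image f) := by
    constructor
    · intro e he
      rcases Finset.mem_union.1 he with he | he
      · exact (Finset.mem_powersetCard.1 (hCA he)).2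
      · obtain ⟨S, hS, rfl⟩ := Finset.mem_image.1 he
        exact (hf S hS).2
    · intro S hS
      by_cases hdis : Disjoint (Finset.powersetCard r S) C
      · have hSB : S ∈ B := Finset.mem_filter.2
          ⟨Finset.mem_powersetCard.2 ⟨Finset.subset_univ _, hS⟩, hdis⟩
        exact ⟨f S, Finset.mem_union_right _ (Finset.mem_image_of_mem _ hSB), (hf S hSB).1⟩
      · obtain ⟨x, hx, hxC⟩ := Finset.not_disjoint_iff.1 hdis
        exact ⟨x, Finset.mem_union_left _ hxC, (Finset.mem_powersetCard.1 hx).1⟩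
  have hexp : ∑ S ∈ Finset.powersetCard s (Finset.univ : Finset (Fin q)),
      (1 - p) ^ (Finset.powersetCard r S ∩ Finset.powersetCard r Finset.univ).card =
      (1 - p) ^ s.choose r * q.choose s := by
    rw [Finset.sum_congr rfl (g := fun _ => (1 - p) ^ s.choose r)]
    · simp [mul_comm]
    · intro S hS
      rw [Finset.inter_eq_left.2 (Finset.powersetCard_mono (Finset.subset_univ _)),
        Finset.card_powersetCard, (Finset.mem_powersetCard.1 hS).2]
  rw [hexp] at hC
  simp only [Finset.sum_const, Finset.card_powersetCard, Finset.card_univ, Fintype.card_fin,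
    nsmul_eq_mul, mul_one] at hC
  refine le_trans ?_ hC
  exact_mod_cast (turanNumber_le_card hH).trans
    ((Finset.card_union_le _ _).trans (Nat.add_le_add_left Finset.card_image_le _))

/-- Overwriting the value at `j`, which the condition forces to be `f i`, by a free colour is a
bijection onto all colourings. -/
theorem card_fun_apply_eq_mul {n q : ℕ} {i j : Fin n} (hij : i ≠ j) :
    (Finset.univ.filter fun f : Fin n → Fin q => f i = f j).card * q = q ^ n := by
  classical
  have : (Finset.univ.filter fun f : Fin n → Fin q => f i = f j).card * q =
      Fintype.card (Fin n → Fin q) := by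
    have hq : (Finset.univ : Finset (Fin q)).card = q := by simp
    refine Eq.trans (by rw [Finset.card_product, hq]) ((?_ :
      ((Finset.univ.filter fun f : Fin n → Fin q => f i = f j) ×ˢ
        (Finset.univ : Finset (Fin q))).card = _).trans Finset.card_univ)
    refine Finset.card_bij' (fun z _ => Function.update z.1 j z.2)
      (fun f _ => (Function.update f j (f i), f j)) ?_ ?_ ?_ ?_
    · simp
    · intro f _
      simp [hij]
    · rintro ⟨f, c⟩ hf
      have hf : f i = f j := by simpa using hf
      simp [hij, hf]
    · intro f _
      simp
  simpa using this

/-- Blow-up of a system on `q` vertices: all sets meeting some part twice are added. -/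
theorem turanNumber_blowup_le (n : ℕ) {q s r : ℕ} (hr : 2 ≤ r) (hrs : r ≤ s) (hrq : r ≤ q) :
    (turanNumber n s r : ℝ) ≤
      n.choose r * ((r : ℝ) ^ 2 / q + (turanNumber q s r : ℝ) / q.choose r) := by
  classical
  obtain ⟨D, hD, hDc⟩ := exists_turanNumber q hrs
  set U : Finset (Finset (Fin n)) := Finset.powersetCard r Finset.univ with hU
  have hUc : U.card = n.choose r := by simp [hU]
  have hq0 : (0 : ℝ) < q := by exact_mod_cast (by omega : 0 < q)
  have hch0 : (0 : ℝ) < q.choose r := by exact_mod_cast Nat.choose_pos hrq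
  let H₁ : (Fin n → Fin q) → Finset (Finset (Fin n)) := fun f =>
    U.filter fun X => ∃ i ∈ X, ∃ j ∈ X, i ≠ j ∧ f i = f j
  let H₂ : (Fin n → Fin q) → Finset (Finset (Fin n)) := fun f =>
    U.filter fun X => Set.InjOn f X ∧ X.image f ∈ D
  have hH : ∀ f, IsTuranSystem s r (H₁ f ∪ H₂ f) := by
    intro f
    constructor
    · intro e he
      rcases Finset.mem_union.1 he with he | he
      · exact (Finset.mem_powersetCard.1 (Finset.mem_filter.1 he).1).2
      · exact (Finset.mem_powersetCard.1 (Finset.mem_filter.1 he).1).2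
    · intro S hS
      by_cases hinj : Set.InjOn f S
      · obtain ⟨e, he, heS⟩ := hD.2 (S.image f) (by rw [Finset.card_image_of_injOn hinj, hS])
        obtain ⟨X, hXS, rfl⟩ := Finset.subset_image_iff.1 heS
        have hXinj : Set.InjOn f X := hinj.mono hXS
        refine ⟨X, Finset.mem_union_right _ (Finset.mem_filter.2
          ⟨Finset.mem_powersetCard.2 ⟨Finset.subset_univ _, ?_⟩, hXinj, he⟩), hXS⟩
        rw [← Finset.card_image_of_injOn hXinj]
        exact hD.1 _ he
      · simp only [Set.InjOn, not_forall] at hinj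
        obtain ⟨i, hi, j, hj, hf, hij⟩ := hinj
        obtain ⟨X, hX1, hX2, hXc⟩ := Finset.exists_subsuperset_card_eq
          (s := {i, j}) (t := S) (n := r)
          (Finset.insert_subset hi (Finset.singleton_subset_iff.2 hj))
          (by rw [Finset.card_pair hij]; exact hr) (hS ▸ hrs)
        exact ⟨X, Finset.mem_union_left _ (Finset.mem_filter.2
          ⟨Finset.mem_powersetCard.2 ⟨Finset.subset_univ _, hXc⟩, i, hX1 (by simp), j,
            hX1 (by simp), hij, hf⟩), hX2⟩
  -- Union bound: at most `r²` ordered pairs of vertices of `X`, each monochromatic with probability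
  -- `1/q`.
  have hsum₁ : ∑ f, ((H₁ f).card : ℝ) ≤ n.choose r * ((r : ℝ) ^ 2 / q) * q ^ n := by
    have h := Finset.sum_card_bipartiteAbove_eq_sum_card_bipartiteBelow
      (s := (Finset.univ : Finset (Fin n → Fin q))) (t := U)
      (fun f X => ∃ i ∈ X, ∃ j ∈ X, i ≠ j ∧ f i = f j)
    simp only [Finset.bipartiteAbove, Finset.bipartiteBelow] at h
    have hX : ∀ X ∈ U, ((Finset.univ.filter fun f : Fin n → Fin q =>
        ∃ i ∈ X, ∃ j ∈ X, i ≠ j ∧ f i = f j).card : ℝ) ≤ (r : ℝ) ^ 2 / q * q ^ n := by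
      intro X hX
      have hXc := (Finset.mem_powersetCard.1 hX).2
      have hsub : (Finset.univ.filter fun f : Fin n → Fin q =>
          ∃ i ∈ X, ∃ j ∈ X, i ≠ j ∧ f i = f j) ⊆
          X.offDiag.biUnion fun z => Finset.univ.filter fun f : Fin n → Fin q => f z.1 = f z.2 := by
        intro f hf
        obtain ⟨i, hi, j, hj, hij, hfij⟩ := (Finset.mem_filter.1 hf).2
        exact Finset.mem_biUnion.2 ⟨(i, j), Finset.mem_offDiag.2 ⟨hi, hj, hij⟩,
          Finset.mem_filter.2 ⟨Finset.mem_univ _, hfij⟩⟩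
      have hb := (Finset.card_le_card hsub).trans Finset.card_biUnion_le
      have hz : ∀ z ∈ X.offDiag, ((Finset.univ.filter
          fun f : Fin n → Fin q => f z.1 = f z.2).card : ℝ) = q ^ n / q := by
        intro z hz
        rw [eq_div_iff hq0.ne']
        exact_mod_cast card_fun_apply_eq_mul (q := q) (Finset.mem_offDiag.1 hz).2.2
      have hb' : ((Finset.univ.filter fun f : Fin n → Fin q =>
          ∃ i ∈ X, ∃ j ∈ X, i ≠ j ∧ f i = f j).card : ℝ) ≤
          ∑ z ∈ X.offDiag, ((Finset.univ.filter
          fun f : Fin n → Fin q => f z.1 = f z.2).card : ℝ) := by exact_mod_cast hb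
      rw [Finset.sum_congr rfl hz, Finset.sum_const, nsmul_eq_mul] at hb'
      have hoff : (X.offDiag.card : ℝ) ≤ (r : ℝ) ^ 2 := by
        rw [Finset.offDiag_card, hXc, sq]
        exact_mod_cast Nat.sub_le _ _
      calc _ ≤ _ := hb'
        _ ≤ (r : ℝ) ^ 2 * (q ^ n / q) := mul_le_mul_of_nonneg_right hoff (by positivity)
        _ = _ := by ring
    have h' : ∑ f, ((H₁ f).card : ℝ) = ∑ X ∈ U, ((Finset.univ.filter fun f : Fin n → Fin q =>
        ∃ i ∈ X, ∃ j ∈ X, i ≠ j ∧ f i = f j).card : ℝ) := by exact_mod_cast h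
    rw [h']
    refine (Finset.sum_le_sum hX).trans (le_of_eq ?_)
    rw [Finset.sum_const, hUc, nsmul_eq_mul, mul_assoc]
  -- Recolouring by a permutation chosen by averaging brings the images of rainbow sets into `D` at
  -- most at its density. It leaves every `H₁ f` unchanged, since `σ` is injective.
  have hsum₂ : ∃ σ : Equiv.Perm (Fin q), ∑ f : Fin n → Fin q, ((H₂ (σ ∘ f)).card : ℝ) ≤
      n.choose r * ((turanNumber q s r : ℝ) / q.choose r) * q ^ n := by
    let P : Finset ((Fin n → Fin q) × Finset (Fin n)) :=
      (Finset.univ ×ˢ U).filter fun z => Set.InjOn z.1 z.2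
    obtain ⟨σ, hσ⟩ := exists_perm_card_filter_mul_le hD.1 P (fun z => z.2.image z.1) (by
      intro z hz
      obtain ⟨hz, hinj⟩ := Finset.mem_filter.1 hz
      rw [Finset.card_image_of_injOn hinj]
      exact (Finset.mem_powersetCard.1 (Finset.mem_product.1 hz).2).2)
    refine ⟨σ, ?_⟩
    have hP : (P.card : ℝ) ≤ q ^ n * n.choose r := by
      have : P.card ≤ q ^ n * n.choose r := by
        refine (Finset.card_filter_le _ _).trans (le_of_eq ?_)
        rw [Finset.card_product, hUc]
        simp
      exact_mod_cast this
    have hcount : ∑ f : Fin n → Fin q, (H₂ (σ ∘ f)).card =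
        (P.filter fun z => (z.2.image z.1).map σ.toEmbedding ∈ D).card := by
      rw [Finset.card_eq_sum_card_fiberwise (f := Prod.fst) (t := Finset.univ)
        (fun z _ => Finset.mem_coe.2 (Finset.mem_univ _))]
      refine Finset.sum_congr rfl fun f _ => ?_
      have hmap : ∀ X : Finset (Fin n), (X.image f).map σ.toEmbedding = X.image (σ ∘ f) := by
        intro X
        rw [Finset.map_eq_image, Finset.image_image]
        rfl
      refine Finset.card_bij (fun X _ => (f, X)) ?_ ?_ ?_
      · intro X hX
        obtain ⟨hXU, hinj, hXD⟩ := Finset.mem_filter.1 hX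
        simp only [P, Finset.mem_filter, Finset.mem_product, Finset.mem_univ, true_and, hmap]
        exact ⟨⟨⟨hXU, hinj.of_comp⟩, hXD⟩, trivial⟩
      · intro X _ Y _ hXY
        exact (Prod.ext_iff.1 hXY).2
      · rintro ⟨g, X⟩ hz
        simp only [P, Finset.mem_filter, Finset.mem_product, Finset.mem_univ, true_and] at hz
        obtain ⟨⟨⟨hXU, hinj⟩, hXD⟩, rfl⟩ := hz
        exact ⟨X, Finset.mem_filter.2 ⟨hXU, σ.injective.comp_injOn hinj, hmap X ▸ hXD⟩, rfl⟩
    have hσ' : ((P.filter fun z => (z.2.image z.1).map σ.toEmbedding ∈ D).card : ℝ) *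
        q.choose r ≤ P.card * turanNumber q s r := by
      rw [← hDc]
      exact_mod_cast hσ
    have hcount' : ∑ f : Fin n → Fin q, ((H₂ (σ ∘ f)).card : ℝ) =
        ((P.filter fun z => (z.2.image z.1).map σ.toEmbedding ∈ D).card : ℝ) := by
      exact_mod_cast hcount
    rw [hcount']
    calc _ ≤ (P.card * turanNumber q s r : ℝ) / q.choose r := (le_div_iff₀ hch0).2 hσ'
      _ ≤ (q ^ n * n.choose r * turanNumber q s r : ℝ) / q.choose r := by gcongr
      _ = _ := by ring
  obtain ⟨σ, hσ⟩ := hsum₂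
  have hinv : ∑ f : Fin n → Fin q, ((H₁ (σ ∘ f)).card : ℝ) = ∑ f, ((H₁ f).card : ℝ) := by
    refine Finset.sum_congr rfl fun f _ => ?_
    have : H₁ (σ ∘ f) = H₁ f := by
      ext X
      simp [H₁]
    rw [this]
  have htot : ∑ _f : Fin n → Fin q, (turanNumber n s r : ℝ) ≤
      ∑ f : Fin n → Fin q, (((H₁ (σ ∘ f)).card : ℝ) + ((H₂ (σ ∘ f)).card : ℝ)) := by
    refine Finset.sum_le_sum fun f _ => ?_
    exact_mod_cast (turanNumber_le_card (hH (σ ∘ f))).trans (Finset.card_union_le _ _)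
  rw [Finset.sum_add_distrib, hinv, Finset.sum_const, nsmul_eq_mul] at htot
  have hqn : (0 : ℝ) < (q : ℝ) ^ n := by positivity
  refine le_of_mul_le_mul_right ?_ hqn
  have hcard : ((Finset.univ : Finset (Fin n → Fin q)).card : ℝ) = (q : ℝ) ^ n := by simp
  rw [hcard] at htot
  linarith

theorem turanDensity_blowup_le {q s r : ℕ} (hr : 2 ≤ r) (hrs : r ≤ s) (hrq : r ≤ q) :
    turanDensity s r ≤ (r : ℝ) ^ 2 / q + (turanNumber q s r : ℝ) / q.choose r := by
  refine le_of_tendsto (tendsto_turanDensity hrs) ?_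
  filter_upwards [eventually_ge_atTop r] with n hn
  have hpos : (0 : ℝ) < n.choose r := by exact_mod_cast Nat.choose_pos hn
  rw [div_le_iff₀ hpos, mul_comm]
  exact turanNumber_blowup_le n hr hrs hrq

/-! ### Random and prefix bounds for `μ` -/

theorem turanDensity_nonneg {s r : ℕ} (h : r ≤ s) : 0 ≤ turanDensity s r :=
  ge_of_tendsto' (tendsto_turanDensity h) fun n => by positivity

theorem turanDensity_le_one {s r : ℕ} (h : r ≤ s) : turanDensity s r ≤ 1 :=
  le_of_tendsto' (tendsto_turanDensity h) fun n =>
    div_le_one_of_le₀ (by exact_mod_cast turanNumber_le_choose n h) (by positivity)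

theorem turanMu_nonneg {s r : ℕ} (h : r ≤ s) : 0 ≤ turanMu s r :=
  mul_nonneg (turanDensity_nonneg h) (by positivity)

theorem turanMu_le_choose {s r : ℕ} (h : r ≤ s) : turanMu s r ≤ s.choose r :=
  mul_le_of_le_one_left (by positivity) (turanDensity_le_one h)

theorem one_sub_pow_le_exp {p : ℝ} (hp₁ : p ≤ 1) (N : ℕ) :
    (1 - p) ^ N ≤ Real.exp (-(p * N)) := by
  calc (1 - p) ^ N ≤ Real.exp (-p) ^ N :=
        pow_le_pow_left₀ (by linarith) (Real.one_sub_le_exp_neg p) N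
    _ = Real.exp (-(p * N)) := by rw [← Real.exp_nat_mul]; ring_nf

/-- The size `q = r²C` makes the blow-up term contribute exactly `1` to `μ`. With `p = c/C` and `c =
R log q`, the missed sets contribute at most `e^(-c) q^R = 1`. If `c ≥ C`, the trivial bound `μ ≤ C`
suffices. -/
theorem turanMu_random_le {r R : ℕ} (hr : 2 ≤ r) :
    turanMu (r + R) r ≤ 2 + R * Real.log ((r : ℝ) ^ 2 * ((r + R).choose R : ℝ)) := by
  have hsym : (r + R).choose R = (r + R).choose r := (Nat.choose_symm_add).symm
  rw [hsym]
  set C := (r + R).choose r with hC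
  have hC0 : 0 < C := Nat.choose_pos (Nat.le_add_right _ _)
  have hC0' : (0 : ℝ) < C := by exact_mod_cast hC0
  have hr0 : (0 : ℝ) < r := by exact_mod_cast (by omega : 0 < r)
  set q := r ^ 2 * C with hq
  have hrq : r ≤ q := by nlinarith
  have hqr : (q : ℝ) = (r : ℝ) ^ 2 * C := by rw [hq]; push_cast; ring
  have hq0 : (0 : ℝ) < q := by rw [hqr]; positivity
  rw [← hqr]
  have hc0 : 0 ≤ R * Real.log q :=
    mul_nonneg (by positivity) (Real.log_natCast_nonneg q)
  set c := R * Real.log (q : ℝ) with hc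
  rcases le_or_gt (C : ℝ) c with hle | hlt
  · have := turanMu_le_choose (Nat.le_add_right r R)
    rw [← hC] at this
    linarith
  have hp₁ : c / C ≤ 1 := (div_le_one hC0').2 hlt.le
  have h1 := turanDensity_blowup_le hr (Nat.le_add_right r R) hrq
  have h2 := turanNumber_random_le q (Nat.le_add_right r R) (div_nonneg hc0 hC0'.le) hp₁
  have hQ : (0 : ℝ) < q.choose r := by exact_mod_cast Nat.choose_pos hrq
  -- From `C(q,r+R) C(r+R,r) = C(q,r) C(q-r,R)`.
  have hmul : (q.choose (r + R) : ℝ) * C ≤ q.choose r * (q : ℝ) ^ R := by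
    have h3 : q.choose (r + R) * C ≤ q.choose r * q ^ R := by
      rcases le_or_gt (r + R) q with h | h
      · rw [hC, Nat.choose_mul (Nat.le_add_right r R), Nat.add_sub_cancel_left]
        exact Nat.mul_le_mul_left _ ((Nat.choose_le_pow _ _).trans
          (Nat.pow_le_pow_left (Nat.sub_le _ _) _))
      · rw [Nat.choose_eq_zero_of_lt h]
        simp
    exact_mod_cast h3
  have hexp : (1 - c / C) ^ C * (q : ℝ) ^ R ≤ 1 := by
    calc (1 - c / C) ^ C * (q : ℝ) ^ R ≤ Real.exp (-(c / C * C)) * (q : ℝ) ^ R :=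
          mul_le_mul_of_nonneg_right (one_sub_pow_le_exp hp₁ C) (by positivity)
      _ = 1 := by
          rw [div_mul_cancel₀ _ hC0'.ne', hc, Real.exp_neg, Real.exp_nat_mul, Real.exp_log hq0,
            inv_mul_cancel₀ (by positivity)]
  have h4 : (turanNumber q (r + R) r : ℝ) / q.choose r * C ≤ c + 1 := by
    rw [div_mul_eq_mul_div, div_le_iff₀ hQ]
    calc (turanNumber q (r + R) r : ℝ) * C
        ≤ (c / C * q.choose r + (1 - c / C) ^ C * q.choose (r + R)) * C :=
          mul_le_mul_of_nonneg_right h2 hC0'.le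
      _ = c * q.choose r + (1 - c / C) ^ C * (q.choose (r + R) * C) := by
          field_simp
      _ ≤ c * q.choose r + (1 - c / C) ^ C * (q.choose r * (q : ℝ) ^ R) := by
          gcongr
      _ = c * q.choose r + ((1 - c / C) ^ C * (q : ℝ) ^ R) * q.choose r := by ring
      _ ≤ c * q.choose r + 1 * q.choose r := by gcongr
      _ = (c + 1) * q.choose r := by ring
  have h5 : (r : ℝ) ^ 2 / q * C = 1 := by
    rw [hqr]
    field_simp
  calc turanMu (r + R) r = turanDensity (r + R) r * C := rfl
    _ ≤ ((r : ℝ) ^ 2 / q + (turanNumber q (r + R) r : ℝ) / q.choose r) * C := by gcongr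
    _ = (r : ℝ) ^ 2 / q * C + (turanNumber q (r + R) r : ℝ) / q.choose r * C := by ring
    _ ≤ 2 + c := by linarith

/-- This is the prefix bound at `p = c / C(r+R,r)`, `r = a + d + R`, in the scale of `μ`. When that
`p` would be at least `1`, the trivial bound takes over. -/
theorem turanMu_prefix_le (a d R : ℕ) {c : ℝ} (hc : 0 ≤ c) :
    turanMu (a + d + R + R) (a + d + R) ≤
      c + Real.exp (-(c * ((a + R).choose a : ℝ) / ((a + d + R + R).choose (a + d + R) : ℝ))) *
        (((a + d + R + R).choose (a + d + R) : ℝ) / ((d + R).choose d : ℝ)) *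
          turanMu (d + R) d := by
  set C := (a + d + R + R).choose (a + d + R) with hC
  have hC0 : (0 : ℝ) < C := by exact_mod_cast Nat.choose_pos (Nat.le_add_right _ _)
  have hD0 : (0 : ℝ) < (d + R).choose d := by exact_mod_cast Nat.choose_pos (Nat.le_add_right _ _)
  have hmu := turanMu_nonneg (Nat.le_add_right d R)
  rcases le_or_gt (C : ℝ) c with hle | hlt
  · have h1 := turanMu_le_choose (Nat.le_add_right (a + d + R) R)
    rw [← hC] at h1
    have : 0 ≤ Real.exp (-(c * ((a + R).choose a : ℝ) / C)) * (C / ((d + R).choose d : ℝ)) *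
        turanMu (d + R) d := by positivity
    linarith
  have hp₁ : c / C ≤ 1 := (div_le_one hC0).2 hlt.le
  have h := turanDensity_prefix_le a d R (div_nonneg hc hC0.le) hp₁
  have h2 := one_sub_pow_le_exp hp₁ ((a + R).choose a)
  have ht := turanDensity_nonneg (Nat.le_add_right d R)
  calc turanMu (a + d + R + R) (a + d + R) = turanDensity (a + d + R + R) (a + d + R) * C := rfl
    _ ≤ (c / C + Real.exp (-(c / C * ((a + R).choose a : ℝ))) * turanDensity (d + R) d) * C := by
        gcongr
        exact h.trans (by gcongr)
    _ = c + Real.exp (-(c * ((a + R).choose a : ℝ) / C)) * (C / ((d + R).choose d : ℝ)) *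
          turanMu (d + R) d := by
        rw [turanMu, div_mul_eq_mul_div c]
        field_simp

/-! ### Estimates for binomial coefficients -/

theorem choose_div_choose_le {N M R : ℕ} (h : R ≤ M) :
    (N.choose R : ℝ) / M.choose R ≤ ((N : ℝ) / ((M : ℝ) + 1 - R)) ^ R := by
  have h0 : (0 : ℝ) < M.choose R := by exact_mod_cast Nat.choose_pos h
  have hf : (0 : ℝ) < R.factorial := by exact_mod_cast Nat.factorial_pos R
  have hMR : (R : ℝ) ≤ M := by exact_mod_cast h
  have h1 : (R.factorial : ℝ) * N.choose R ≤ (N : ℝ) ^ R := by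
    have := Nat.descFactorial_le_pow N R
    rw [Nat.descFactorial_eq_factorial_mul_choose] at this
    exact_mod_cast this
  have h2 : ((M : ℝ) + 1 - R) ^ R ≤ R.factorial * M.choose R := by
    have := Nat.pow_sub_le_descFactorial M R
    rw [Nat.descFactorial_eq_factorial_mul_choose] at this
    have h3 : ((M + 1 - R : ℕ) : ℝ) ^ R ≤ R.factorial * M.choose R := by exact_mod_cast this
    rwa [Nat.cast_sub (by omega), Nat.cast_add, Nat.cast_one] at h3
  have h4 : (0 : ℝ) < ((M : ℝ) + 1 - R) ^ R := pow_pos (by linarith) _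
  rw [div_pow, div_le_div_iff₀ h0 h4]
  refine le_of_mul_le_mul_left ?_ hf
  calc (R.factorial : ℝ) * (N.choose R * ((M : ℝ) + 1 - R) ^ R)
      = (R.factorial * N.choose R) * ((M : ℝ) + 1 - R) ^ R := by ring
    _ ≤ (N : ℝ) ^ R * (R.factorial * M.choose R) := by gcongr
    _ = _ := by ring

theorem choose_div_choose_le_exp {N M R : ℕ} (h : R ≤ M) {x : ℝ}
    (hx : (N : ℝ) ≤ (1 + x) * ((M : ℝ) + 1 - R)) :
    (N.choose R : ℝ) / M.choose R ≤ Real.exp (R * x) := by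
  have hMR : (R : ℝ) ≤ M := by exact_mod_cast h
  have h0 : (0 : ℝ) < (M : ℝ) + 1 - R := by linarith
  refine (choose_div_choose_le h).trans ?_
  rw [Real.exp_nat_mul]
  refine pow_le_pow_left₀ (by positivity) ?_ R
  rw [div_le_iff₀ h0]
  refine hx.trans (mul_le_mul_of_nonneg_right ?_ h0.le)
  rw [add_comm]
  exact Real.add_one_le_exp x

theorem log_choose_le {n R : ℕ} (hR : 1 ≤ R) (h : R ≤ n) :
    Real.log (n.choose R : ℝ) ≤ R * (1 + Real.log ((n : ℝ) / R)) := by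
  have hR0 : (0 : ℝ) < R := by exact_mod_cast hR
  have hn0 : (0 : ℝ) < n := by exact_mod_cast hR.trans h
  have hC0 : (0 : ℝ) < n.choose R := by exact_mod_cast Nat.choose_pos h
  have hf : (0 : ℝ) < R.factorial := by exact_mod_cast Nat.factorial_pos R
  have h1 : (R.factorial : ℝ) * n.choose R ≤ (n : ℝ) ^ R := by
    have := Nat.descFactorial_le_pow n R
    rw [Nat.descFactorial_eq_factorial_mul_choose] at this
    exact_mod_cast this
  have h2 : (R : ℝ) ^ R ≤ Real.exp R * R.factorial := by
    have := Real.pow_div_factorial_le_exp (R : ℝ) hR0.le R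
    rwa [div_le_iff₀ hf] at this
  have h3 : (n.choose R : ℝ) ≤ (Real.exp 1 * ((n : ℝ) / R)) ^ R := by
    rw [mul_pow, div_pow, ← mul_div_assoc, le_div_iff₀ (by positivity), ← Real.exp_nat_mul, mul_one]
    calc (n.choose R : ℝ) * (R : ℝ) ^ R ≤ n.choose R * (Real.exp R * R.factorial) := by gcongr
      _ = Real.exp R * (R.factorial * n.choose R) := by ring
      _ ≤ Real.exp R * (n : ℝ) ^ R := by gcongr
  calc Real.log (n.choose R : ℝ) ≤ Real.log ((Real.exp 1 * ((n : ℝ) / R)) ^ R) :=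
        Real.log_le_log hC0 h3
    _ = R * (1 + Real.log ((n : ℝ) / R)) := by
        rw [Real.log_pow, Real.log_mul (Real.exp_pos 1).ne' (by positivity), Real.log_exp]

/-- `C(r+R,R)` outgrows every fixed power of `r`, uniformly in `r`, as `R → ∞`. -/
theorem exists_mul_one_add_log_le_log_choose (K : ℕ) :
    ∃ R₀ : ℕ, ∀ r R : ℕ, 1 ≤ r → R₀ ≤ R →
      K * (1 + Real.log r) ≤ Real.log ((r + R).choose R : ℝ) := by
  -- For `r > B`, `C(r+R,R) ≥ (r/(m+1))^m` while `log r ≥ 1 + 2 log (m+1)`. Doubling the exponent to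
  -- `m = 2K` thus leaves `K (1 + log r)`. For `r ≤ B`, already `C(r+R,R) ≥ R ≥ N` suffices.
  set m := 2 * K with hm
  obtain ⟨B, hB⟩ := exists_nat_gt (Real.exp 1 * ((m : ℝ) + 1) ^ 2)
  obtain ⟨N, hN⟩ := exists_nat_gt (Real.exp (K * (1 + Real.log B)))
  have hB0 : (0 : ℝ) < B := lt_trans (by positivity) hB
  refine ⟨max m N, fun r R hr hR => ?_⟩
  have hr0 : (0 : ℝ) < r := by exact_mod_cast hr
  have hC0 : (0 : ℝ) < (r + R).choose R := by exact_mod_cast Nat.choose_pos (Nat.le_add_left _ _)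
  rcases le_or_gt r B with hrB | hrB
  · rw [Real.le_log_iff_exp_le hC0]
    have h1 : Real.exp (K * (1 + Real.log r)) ≤ Real.exp (K * (1 + Real.log B)) := by
      have : (r : ℝ) ≤ B := by exact_mod_cast hrB
      gcongr
    have h2 : N ≤ (r + R).choose R := by
      calc N ≤ R := (le_max_right _ _).trans hR
        _ ≤ (1 + R).choose R := by rw [add_comm, Nat.choose_succ_self_right]; omega
        _ ≤ (r + R).choose R := Nat.choose_le_choose _ (by omega)
    exact h1.trans (hN.le.trans (by exact_mod_cast h2))
  · have hrB' : (B : ℝ) < r := by exact_mod_cast hrB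
    have h1 : (r + m).choose m ≤ (r + R).choose R := by
      rw [← Nat.choose_symm_add, ← Nat.choose_symm_add]
      exact Nat.choose_le_choose _ (by have := (le_max_left m N).trans hR; omega)
    have h2 : ((r : ℝ) / ((m : ℝ) + 1)) ^ m ≤ (r + m).choose m := by
      have h3 : ((r + m + 1 - m : ℕ) : ℝ) ^ m / m.factorial ≤ (r + m).choose m := by
        have h := Nat.pow_le_choose (α := ℝ) m (r + m)
        exact_mod_cast h
      refine le_trans ?_ h3
      rw [div_pow]
      have hfac : (m.factorial : ℝ) ≤ ((m : ℝ) + 1) ^ m := by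
        have : m.factorial ≤ (m + 1) ^ m :=
          (Nat.factorial_le_pow m).trans (Nat.pow_le_pow_left (Nat.le_succ m) m)
        exact_mod_cast this
      have hf : (0 : ℝ) < m.factorial := by exact_mod_cast Nat.factorial_pos m
      have hcast : (r : ℝ) ≤ ((r + m + 1 - m : ℕ) : ℝ) := by exact_mod_cast (by omega)
      gcongr
    have h3 : Real.log (((r : ℝ) / ((m : ℝ) + 1)) ^ m) ≤ Real.log ((r + R).choose R : ℝ) :=
      Real.log_le_log (by positivity) (h2.trans (by exact_mod_cast h1))
    refine le_trans ?_ h3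
    have hlog : Real.log (Real.exp 1 * ((m : ℝ) + 1) ^ 2) ≤ Real.log r :=
      Real.log_le_log (by positivity) (hB.le.trans hrB'.le)
    rw [Real.log_mul (Real.exp_pos 1).ne' (by positivity), Real.log_exp, Real.log_pow] at hlog
    rw [Real.log_pow, Real.log_div hr0.ne' (by positivity)]
    have hK0 : (0 : ℝ) ≤ K := by positivity
    have hmK : (m : ℝ) = 2 * K := by rw [hm]; push_cast; ring
    push_cast at hlog
    generalize Real.log ((m : ℝ) + 1) = y at *
    rw [hmK]
    nlinarith

/-! ### The bound (i) -/

theorem exists_turanMu_le_log_choose (ε : ℝ) (hε : 0 < ε) :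
    ∃ r₀ : ℕ, ∀ r R : ℕ, 1 ≤ r → r₀ ≤ R →
      turanMu (r + R) r ≤ (1 + ε) * (R : ℝ) * Real.log ((r + R).choose R : ℝ) := by
  obtain ⟨K, hK⟩ := exists_nat_gt (2 + 2 / ε)
  obtain ⟨R₀, hR₀⟩ := exists_mul_one_add_log_le_log_choose K
  have hKε : 2 ≤ ε * K := by
    have : 2 / ε ≤ K := by linarith
    rwa [div_le_iff₀ hε, mul_comm] at this
  have hK2 : (2 : ℝ) ≤ K := by
    have : 0 < 2 / ε := by positivity
    linarith
  refine ⟨max 1 R₀, fun r R hr hR => ?_⟩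
  have hL := hR₀ r R hr ((le_max_right _ _).trans hR)
  have hR1 : (1 : ℝ) ≤ R := by exact_mod_cast (le_max_left _ _).trans hR
  have hlr : 0 ≤ Real.log (r : ℝ) := Real.log_natCast_nonneg r
  set L := Real.log ((r + R).choose R : ℝ) with hLdef
  have hL2 : 2 ≤ L := by nlinarith
  -- The blow-up needs `r ≥ 2`; for `r = 1` the trivial bound `R + 1 ≤ R L` holds because `L ≥ 2`.
  rcases hr.eq_or_lt with rfl | hr2
  · have h := turanMu_le_choose (Nat.le_add_right 1 R)
    rw [Nat.choose_one_right] at h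
    push_cast at h
    have : 0 ≤ ε * R * L := by positivity
    nlinarith
  · have h := turanMu_random_le (R := R) hr2
    have hr0 : (0 : ℝ) < r := by exact_mod_cast hr
    have hC0 : (0 : ℝ) < (r + R).choose R := by
      exact_mod_cast Nat.choose_pos (Nat.le_add_left _ _)
    rw [Real.log_mul (by positivity) hC0.ne', Real.log_pow, ← hLdef] at h
    push_cast at h
    have h1 : 2 * (1 + Real.log r) ≤ ε * L := by
      calc 2 * (1 + Real.log r) ≤ ε * K * (1 + Real.log r) := by gcongr
        _ = ε * (K * (1 + Real.log r)) := by ring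
        _ ≤ ε * L := by gcongr
    have h2 : R * (2 * (1 + Real.log r)) ≤ R * (ε * L) := by gcongr
    nlinarith

/-! ### The bound (ii) -/

/-- The recursive step: the first `a = r - b` elements with `b ≈ r / (m R)`. -/
theorem turanMu_recursive_le {m r R : ℕ} (hm : 2 ≤ m) (hR : 1 ≤ R) (hr : 2 * m * R ^ 2 ≤ r)
    (hcrude : ∀ d < r, turanMu (d + R) d ≤ (R : ℝ) ^ 3) :
    turanMu (r + R) r ≤
      Real.exp (3 / m) * (R * Real.log (4 * m * R) + 3 * Real.log R) + 1 := by
  have hmR : 0 < m * R := Nat.mul_pos (by omega) hR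
  set b := r / (m * R) with hb
  have hb2 : 2 * R ≤ b := by
    rw [hb, Nat.le_div_iff_mul_le hmR]
    calc 2 * R * (m * R) = 2 * m * R ^ 2 := by ring
      _ ≤ r := hr
  have hbr : b * (m * R) ≤ r := Nat.div_mul_le_self _ _
  have hrb : r < (b + 1) * (m * R) := by
    rw [mul_comm]
    exact Nat.lt_mul_div_succ r hmR
  have hm2 : (2 : ℝ) ≤ m := by exact_mod_cast hm
  have hR1 : (1 : ℝ) ≤ R := by exact_mod_cast hR
  have hble : b ≤ r := Nat.div_le_self _ _
  obtain ⟨d, hd⟩ : ∃ d, b = d + R := ⟨b - R, by omega⟩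
  obtain ⟨a, ha⟩ : ∃ a, r = a + d + R := ⟨r - b, by omega⟩
  have hd' : (b : ℝ) = d + R := by exact_mod_cast hd
  have ha' : (r : ℝ) = a + b := by rw [hd']; exact_mod_cast ha.trans (add_assoc _ _ _)
  have hbr' : (b : ℝ) * (m * R) ≤ r := by exact_mod_cast hbr
  have hrb' : (r : ℝ) ≤ (b + 1) * (m * R) := by exact_mod_cast hrb.le
  have hb2' : 2 * (R : ℝ) ≤ b := by exact_mod_cast hb2
  have hr' : 2 * (m : ℝ) * (R : ℝ) ^ 2 ≤ r := by exact_mod_cast hr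
  have hmR2 : (2 : ℝ) ≤ m * R := by nlinarith
  have hra : (r : ℝ) ≤ 2 * (a + 1) := by nlinarith [(Nat.cast_nonneg b : (0 : ℝ) ≤ b)]
  have hR0 : (0 : ℝ) < R := by linarith
  have hm0 : (0 : ℝ) < m := by linarith
  -- Relative to `a + 1 ≥ r/2`, removing `b` costs at most `2/(mR)` and the extra `R` at most
  -- `1/(mR)`. The latter is where `r ≥ 2mR²` enters. The `R`-th power turns `3/(mR)` into `3/m`.
  have hX : ((r + R).choose r : ℝ) / (a + R).choose a ≤ Real.exp (3 / m) := by
    rw [Nat.choose_symm_add, Nat.choose_symm_add]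
    have h := choose_div_choose_le_exp (N := r + R) (M := a + R) (R := R) (Nat.le_add_left _ _)
      (x := 3 / (m * R)) (by
        push_cast
        have h1 : (b : ℝ) ≤ 2 * (a + 1) / (m * R) := by
          rw [le_div_iff₀ (by positivity)]
          linarith
        have h2 : (R : ℝ) ≤ (a + 1) / (m * R) := by
          rw [le_div_iff₀ (by positivity)]
          nlinarith
        have h3 : (1 + 3 / (m * R)) * ((a : ℝ) + R + 1 - R) =
            a + 1 + 2 * (a + 1) / (m * R) + (a + 1) / (m * R) := by
          field_simp
          ring
        rw [h3]
        linarith)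
    have h4 : (R : ℝ) * (3 / (m * R)) = 3 / m := by field_simp
    rwa [h4] at h
  have hY : ((r + R).choose r : ℝ) / (d + R).choose d ≤ (4 * m * R) ^ R := by
    rw [Nat.choose_symm_add, Nat.choose_symm_add]
    refine (choose_div_choose_le (Nat.le_add_left _ _)).trans ?_
    have h0 : (0 : ℝ) < ((d + R : ℕ) : ℝ) + 1 - R := by push_cast; linarith
    refine pow_le_pow_left₀ (by positivity) ?_ R
    rw [div_le_iff₀ h0]
    push_cast
    have h1 : (b : ℝ) + 1 ≤ 2 * (d + R + 1 - R) := by linarith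
    have h2 : 2 * (m * R : ℝ) * (b + 1) ≤ 2 * (m * R) * (2 * (d + R + 1 - R)) := by gcongr
    nlinarith
  have hC0 : (0 : ℝ) < (r + R).choose r := by exact_mod_cast Nat.choose_pos (Nat.le_add_right _ _)
  have hA0 : (0 : ℝ) < (a + R).choose a := by exact_mod_cast Nat.choose_pos (Nat.le_add_right _ _)
  have hE0 : 0 ≤ R * Real.log (4 * m * R) + 3 * Real.log R := by
    have h1 : 0 ≤ Real.log (4 * m * R) := Real.log_nonneg (by nlinarith)
    have h2 : 0 ≤ Real.log (R : ℝ) := Real.log_natCast_nonneg R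
    positivity
  have hexp : Real.exp (-(R * Real.log (4 * m * R) + 3 * Real.log R)) =
      ((4 * m * R : ℝ) ^ R * (R : ℝ) ^ 3)⁻¹ := by
    rw [Real.exp_neg, Real.exp_add, Real.exp_nat_mul, Real.exp_log (by positivity)]
    congr 2
    rw [show (3 : ℝ) * Real.log R = (3 : ℕ) * Real.log R by norm_num, Real.exp_nat_mul,
      Real.exp_log hR0]
  -- `exp (-E)` cancels both the ratio `(4mR)^R` from `hY` and the crude bound `R³`, so the
  -- recursive term is at most `1`.
  set E := R * Real.log (4 * m * R) + 3 * Real.log R with hE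
  have h := turanMu_prefix_le a d R
    (c := ((r + R).choose r : ℝ) / (a + R).choose a * E) (by positivity)
  rw [← ha] at h
  have hcancel : ((r + R).choose r : ℝ) / (a + R).choose a * E * (a + R).choose a /
      (r + R).choose r = E := by field_simp
  rw [hcancel, hexp] at h
  refine h.trans (add_le_add (mul_le_mul_of_nonneg_right hX hE0) ?_)
  have hmu := hcrude d (by omega)
  have hmu0 := turanMu_nonneg (Nat.le_add_right d R)
  calc ((4 * m * R : ℝ) ^ R * (R : ℝ) ^ 3)⁻¹ *
        (((r + R).choose r : ℝ) / (d + R).choose d) * turanMu (d + R) d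
      ≤ ((4 * m * R : ℝ) ^ R * (R : ℝ) ^ 3)⁻¹ * (4 * m * R) ^ R * (R : ℝ) ^ 3 := by gcongr
    _ = 1 := by field_simp

/-- The case `d = 0` of the prefix construction. -/
theorem turanMu_le_exp_mul_log_choose {r R : ℕ} (h : 18 * R ≤ r) (hR : 1 ≤ R) :
    turanMu (r + R) r ≤
      Real.exp (18 * (R : ℝ) ^ 2 / r) * Real.log ((r + R).choose R : ℝ) + 1 := by
  obtain ⟨a, ha⟩ : ∃ a, r = a + 0 + R := ⟨r - R, by omega⟩
  have ha' : (r : ℝ) = a + R := by rw [ha]; push_cast; ring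
  have h' : 18 * (R : ℝ) ≤ r := by exact_mod_cast h
  have hR1 : (1 : ℝ) ≤ R := by exact_mod_cast hR
  have hr0 : (0 : ℝ) < r := by linarith
  have hC1 : 1 ≤ (r + R).choose r := Nat.choose_pos (Nat.le_add_right _ _)
  have hC0 : (0 : ℝ) < (r + R).choose r := by exact_mod_cast hC1
  have hA0 : (0 : ℝ) < (a + R).choose a := by exact_mod_cast Nat.choose_pos (Nat.le_add_right _ _)
  have hX : ((r + R).choose r : ℝ) / (a + R).choose a ≤ Real.exp (18 * (R : ℝ) ^ 2 / r) := by
    rw [Nat.choose_symm_add, Nat.choose_symm_add]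
    have h := choose_div_choose_le_exp (N := r + R) (M := a + R) (R := R) (Nat.le_add_left _ _)
      (x := 18 * R / r) (by
        push_cast
        -- Here `a = r - R ≥ 17r/18`, so `36R/(17r)` would do in place of `18R/r`; the latter yields
        -- the factor of (ii).
        have h2 : 2 * (R : ℝ) ≤ 18 * R / r * (a + 1) := by
          rw [div_mul_eq_mul_div, le_div_iff₀ hr0]
          nlinarith
        nlinarith)
    have h4 : (R : ℝ) * (18 * R / r) = 18 * (R : ℝ) ^ 2 / r := by ring
    rwa [h4] at h
  rw [← Nat.choose_symm_add]
  have hlog : 0 ≤ Real.log ((r + R).choose r : ℝ) := Real.log_natCast_nonneg _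
  -- This `c` makes the exponential exactly `1 / C(r+R,r)`, cancelling the ratio to `C(R,0) = 1`;
  -- what remains is `μ(R,0) ≤ 1`.
  have h := turanMu_prefix_le a 0 R
    (c := ((r + R).choose r : ℝ) / (a + R).choose a * Real.log ((r + R).choose r : ℝ))
    (by positivity)
  rw [← ha] at h
  have hcancel : ((r + R).choose r : ℝ) / (a + R).choose a *
      Real.log ((r + R).choose r : ℝ) * (a + R).choose a / (r + R).choose r =
        Real.log ((r + R).choose r : ℝ) := by field_simp
  rw [hcancel, Real.exp_neg, Real.exp_log hC0, Nat.choose_zero_right, Nat.cast_one, div_one,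
    inv_mul_cancel₀ hC0.ne', one_mul] at h
  refine h.trans (add_le_add (mul_le_mul_of_nonneg_right hX hlog) ?_)
  simpa using turanMu_le_choose (Nat.zero_le (0 + R))

/-- Used with `L = log R`, `l = log (4m)` and `x = e^(3/m)`. The lower-order terms cost one factor
`1 + η` and `x` costs another, with `(1 + η)² ≤ 1 + 3η ≤ 1 + ε`. -/
theorem prefix_bound_le {η ε R L l x : ℝ} (hη0 : 0 < η) (hη1 : η ≤ 1) (hηε : 3 * η ≤ ε)
    (hl : 0 ≤ l) (h100 : 100 ≤ L) (hLR : L ≤ R) (hA : 6 + l ≤ η / 2 * L) (hx : x ≤ 1 + η) :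
    x * (R * (l + L) + 3 * L) + 1 ≤ (1 + ε) * R * L := by
  have hR0 : 0 < R := by linarith
  have hRL : 0 < R * L := by positivity
  have h6 : 6 ≤ η * R := by nlinarith
  have h3 : 6 * L ≤ η * R * L := mul_le_mul_of_nonneg_right h6 (by linarith)
  have h4 : R * (6 + l) ≤ R * (η / 2 * L) := mul_le_mul_of_nonneg_left hA hR0.le
  have h5 : R * (l + L) + 3 * L + 1 ≤ (1 + η) * (R * L) := by linarith
  have h0 : 0 ≤ R * (l + L) + 3 * L := by positivity
  calc x * (R * (l + L) + 3 * L) + 1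
      ≤ (1 + η) * (R * (l + L) + 3 * L) + (1 + η) * 1 := by
        gcongr
        linarith
    _ = (1 + η) * (R * (l + L) + 3 * L + 1) := by ring
    _ ≤ (1 + η) * ((1 + η) * (R * L)) := by gcongr
    _ = (1 + η) * (1 + η) * (R * L) := by ring
    _ ≤ (1 + ε) * (R * L) := by
        gcongr
        nlinarith
    _ = (1 + ε) * R * L := by ring

theorem theorem1p2 (ε : ℝ) (hε : 0 < ε) :
    ∃ r₀ : ℕ, ∀ r R : ℕ, 1 ≤ r → r₀ ≤ R →
      turanMu (r + R) r ≤ (1 + ε) * (R : ℝ) * Real.log ((r + R).choose R : ℝ) ∧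
      ((R : ℝ) ≤ Real.sqrt (18 * (r : ℝ) * Real.log (r : ℝ)) →
        turanMu (r + R) r ≤
          Real.exp (18 * (R : ℝ) ^ 2 / (r : ℝ)) * ((1 + ε) * (R : ℝ) * Real.log (R : ℝ))) := by
  obtain ⟨R₁, hR₁⟩ := exists_turanMu_le_log_choose ε hε
  obtain ⟨η, hη0, hη1, hηε⟩ : ∃ η : ℝ, 0 < η ∧ η ≤ 1 ∧ 3 * η ≤ ε :=
    ⟨min 1 (ε / 3), by positivity, min_le_left _ _, by
      have := min_le_right 1 (ε / 3)
      linarith⟩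
  -- Ensures `3/m ≤ η/2`, hence `e^(3/m) ≤ 1/(1 - η/2) ≤ 1 + η`.
  obtain ⟨m, hm⟩ : ∃ m : ℕ, 2 + 6 / η < m := exists_nat_gt _
  have h6 : 0 < 6 / η := by positivity
  have hm2 : 2 ≤ m := by
    have : (2 : ℝ) ≤ m := by linarith
    exact_mod_cast this
  have hm0 : (0 : ℝ) < m := by exact_mod_cast (by omega : 0 < m)
  have hexpm : Real.exp (3 / m) ≤ 1 + η := by
    have h1 : (3 : ℝ) / m ≤ η / 2 := by
      have h2 : 6 / η ≤ m := by linarith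
      rw [div_le_iff₀ hη0] at h2
      rw [div_le_iff₀ hm0]
      linarith
    have h3 : Real.exp (3 / m) ≤ Real.exp (η / 2) := Real.exp_le_exp.2 h1
    have h4 := Real.one_sub_le_exp_neg (η / 2)
    rw [Real.exp_neg] at h4
    have h5 : Real.exp (η / 2) * (1 - η / 2) ≤ 1 := by
      have h := mul_le_mul_of_nonneg_left h4 (Real.exp_pos (η / 2)).le
      rwa [mul_inv_cancel₀ (Real.exp_pos (η / 2)).ne'] at h
    refine h3.trans ?_
    nlinarith [Real.exp_pos (η / 2)]
  set A := 6 + Real.log (4 * m) with hA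
  have hlog4m : 0 ≤ Real.log (4 * m : ℝ) := Real.log_nonneg (by
    have : (2 : ℝ) ≤ m := by exact_mod_cast hm2
    linarith)
  -- The first condition makes the constant `A` at most `(η/2) log R`; the second then gives `(1 +
  -- ε)(A + log R) ≤ R`, the room needed for the crude bound.
  have hev : ∀ᶠ R : ℕ in atTop, 100 + 2 * A / η ≤ Real.log R ∧
      Real.log R ≤ (2 * (1 + ε))⁻¹ * R := by
    have h1 : Tendsto (fun R : ℕ => Real.log (R : ℝ)) atTop atTop :=
      Real.tendsto_log_atTop.comp tendsto_natCast_atTop_atTop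
    have h2 := (Real.isLittleO_log_id_atTop.comp_tendsto
      (tendsto_natCast_atTop_atTop (R := ℝ))).bound (c := (2 * (1 + ε))⁻¹) (by positivity)
    filter_upwards [h1.eventually_ge_atTop (100 + 2 * A / η), h2] with R hR hR'
    refine ⟨hR, (le_abs_self _).trans ?_⟩
    simpa using hR'
  obtain ⟨R₂, hR₂⟩ := eventually_atTop.1 hev
  refine ⟨max 1 (max R₁ R₂), fun r R hr hR => ?_⟩
  have hR1 : 1 ≤ R := (le_max_left _ _).trans hR
  have hRR₁ : R₁ ≤ R := ((le_max_left _ _).trans (le_max_right _ _)).trans hR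
  obtain ⟨hlogA, hlogR⟩ := hR₂ R (((le_max_right _ _).trans (le_max_right _ _)).trans hR)
  refine ⟨hR₁ r R hr hRR₁, fun _ => ?_⟩
  have hR1' : (1 : ℝ) ≤ R := by exact_mod_cast hR1
  have hR0 : (0 : ℝ) < R := by linarith
  have hr0 : (0 : ℝ) < r := by exact_mod_cast hr
  have hlog_mul : Real.log (4 * m * R) = Real.log (4 * m) + Real.log R :=
    Real.log_mul (by positivity) hR0.ne'
  have hlog_lt : Real.log (R : ℝ) ≤ R := (Real.log_le_sub_one_of_pos hR0).trans (by linarith)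
  have hA0 : 0 ≤ 2 * A / η := by positivity
  have hAη : A ≤ η / 2 * Real.log R := by
    have : 2 * A / η ≤ Real.log R := by linarith
    rw [div_le_iff₀ hη0] at this
    linarith
  have h100 : 100 ≤ Real.log (R : ℝ) := by linarith
  set L := Real.log (R : ℝ) with hL
  have hAL : A ≤ L := by nlinarith
  have hbig : (1 + ε) * (A + L) ≤ R := by
    have h1 : (1 + ε) * (A + L) ≤ (2 * (1 + ε)) * L := by nlinarith
    have h2 : (2 * (1 + ε)) * L ≤ R := by
      calc (2 * (1 + ε)) * L ≤ (2 * (1 + ε)) * ((2 * (1 + ε))⁻¹ * R) := by gcongr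
        _ = R := by field_simp
    exact h1.trans h2
  have hexp1 : 1 ≤ Real.exp (18 * (R : ℝ) ^ 2 / r) := Real.one_le_exp (by positivity)
  have hlogC : ∀ r' : ℕ, r' < 2 * m * R ^ 2 →
      Real.log ((r' + R).choose R : ℝ) ≤ R * (1 + Real.log (4 * m) + L) := by
    intro r' hr'
    refine (log_choose_le hR1 (Nat.le_add_left R r')).trans ?_
    rw [add_assoc 1, ← hlog_mul]
    have hr'' : (r' : ℝ) ≤ 2 * m * R ^ 2 := by exact_mod_cast hr'.le
    have hm1 : (1 : ℝ) ≤ m := by exact_mod_cast (by omega : 1 ≤ m)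
    have h1 : ((r' + R : ℕ) : ℝ) / R ≤ 4 * m * R := by
      rw [div_le_iff₀ hR0]
      push_cast
      nlinarith [mul_le_mul hm1 hR1' zero_le_one hm0.le]
    have h2 : (0 : ℝ) < ((r' + R : ℕ) : ℝ) / R := by
      have : (0 : ℝ) < ((r' + R : ℕ) : ℝ) := by exact_mod_cast (by omega)
      positivity
    gcongr
  have hstep : ∀ r' : ℕ, 2 * m * R ^ 2 ≤ r' →
      (∀ d < r', turanMu (d + R) d ≤ (R : ℝ) ^ 3) →
        turanMu (r' + R) r' ≤ (1 + ε) * R * L := by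
    intro r' hr' hcr
    refine (turanMu_recursive_le hm2 hR1 hr' hcr).trans ?_
    rw [hlog_mul]
    exact prefix_bound_le hη0 hη1 hηε hlog4m h100 hlog_lt hAη hexpm
  -- Below `2mR²`, (i) gives at most `R² (1 + ε)(A + L) ≤ R³`. Above it, the recursive step returns
  -- the far stronger `(1 + ε) R L`, so the bound reproduces itself.
  have hcrude : ∀ r' : ℕ, turanMu (r' + R) r' ≤ (R : ℝ) ^ 3 := by
    intro r'
    induction r' using Nat.strong_induction_on with
    | _ r' ih =>
      rcases Nat.eq_zero_or_pos r' with rfl | hpos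
      · have h := turanMu_le_choose (Nat.zero_le (0 + R))
        rw [Nat.choose_zero_right, Nat.cast_one] at h
        exact h.trans (one_le_pow₀ hR1')
      rcases lt_or_ge r' (2 * m * R ^ 2) with hlt | hge
      · refine (hR₁ r' R hpos hRR₁).trans ?_
        calc (1 + ε) * R * Real.log ((r' + R).choose R : ℝ)
            ≤ (1 + ε) * R * (R * (1 + Real.log (4 * m) + L)) := by
              gcongr
              exact hlogC r' hlt
          _ ≤ (1 + ε) * R * (R * (A + L)) := by gcongr; linarith
          _ = (R : ℝ) ^ 2 * ((1 + ε) * (A + L)) := by ring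
          _ ≤ (R : ℝ) ^ 2 * R := by gcongr
          _ = (R : ℝ) ^ 3 := by ring
      · refine (hstep r' hge ih).trans ?_
        have h1 : (1 + ε) * L ≤ R := le_trans (by gcongr; linarith) hbig
        calc (1 + ε) * R * L = R * ((1 + ε) * L) := by ring
          _ ≤ R * R := by gcongr
          _ = (R : ℝ) ^ 2 := by ring
          _ ≤ (R : ℝ) ^ 3 := pow_le_pow_right₀ hR1' (by norm_num)
  have hRL0 : 0 ≤ (1 + ε) * R * L := by positivity
  rcases lt_or_ge (18 * (R : ℝ) ^ 2) (r * L) with hlarge | hsmall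
  · rcases lt_or_ge r (2 * m * R ^ 2) with hlt | hge
    -- Otherwise `r L < 18 R L ≤ 18 R²`, contrary to `hlarge`.
    · have h18 : 18 * R ≤ r := by
        have : 18 * (R : ℝ) ≤ r := by
          by_contra! hcon
          nlinarith
        exact_mod_cast this
      refine (turanMu_le_exp_mul_log_choose h18 hR1).trans ?_
      have h1 := hlogC r hlt
      have h2 : R * (1 + Real.log (4 * m) + L) + 1 ≤ (1 + ε) * R * L := by
        have h4 : R * A ≤ R * (ε * L) := by
          gcongr
          nlinarith
        nlinarith
      calc _ ≤ Real.exp (18 * (R : ℝ) ^ 2 / r) * Real.log ((r + R).choose R : ℝ) +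
            Real.exp (18 * (R : ℝ) ^ 2 / r) := by gcongr
        _ = Real.exp (18 * (R : ℝ) ^ 2 / r) * (Real.log ((r + R).choose R : ℝ) + 1) := by ring
        _ ≤ _ := by
          gcongr
          linarith
    · exact (hstep r hge fun d _ => hcrude d).trans (le_mul_of_one_le_left hRL0 hexp1)
  -- The exponential factor pays for the extra factor `R` in (i), since `log C(r+R,R) ≤ R L` when `e
  -- (r + R)/R ≤ R`.
  · have hRexp : (R : ℝ) ≤ Real.exp (18 * (R : ℝ) ^ 2 / r) := by
      rw [← Real.log_le_iff_le_exp hR0, le_div_iff₀ hr0, mul_comm]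
      exact hsmall
    have hRbig : (100 : ℝ) ≤ R := h100.trans hlog_lt
    have hlogle : Real.log ((r + R).choose R : ℝ) ≤ R * L := by
      refine (log_choose_le hR1 (Nat.le_add_left R r)).trans ?_
      gcongr
      have h1 : Real.exp 1 * (((r + R : ℕ) : ℝ) / R) ≤ R := by
        rw [← mul_div_assoc, div_le_iff₀ hR0]
        push_cast
        have he := Real.exp_one_lt_d9
        have h2 : (r : ℝ) * 100 ≤ 18 * (R : ℝ) ^ 2 := le_trans (by gcongr) hsmall
        nlinarith
      have h2 : (0 : ℝ) < ((r + R : ℕ) : ℝ) / R := by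
        have : (0 : ℝ) < ((r + R : ℕ) : ℝ) := by exact_mod_cast (by omega)
        positivity
      have h3 := Real.log_le_log (by positivity) h1
      rwa [Real.log_mul (Real.exp_pos 1).ne' h2.ne', Real.log_exp] at h3
    calc turanMu (r + R) r ≤ (1 + ε) * R * Real.log ((r + R).choose R : ℝ) := hR₁ r R hr hRR₁
      _ ≤ (1 + ε) * R * (R * L) := by gcongr
      _ = R * ((1 + ε) * R * L) := by ring
      _ ≤ _ := by gcongr
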